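/- Theorem (MTBFA lower bound). Let $P$ be a Markov kernel on a measurable space $\mathbb X$ satisfying Doeblin's condition: there are a probability measure $\phi$ on $\mathbb X$, a number $\lambda>0$ and an integer $l\ge 1$ such that $P^l(x,A)\ge\lambda\,\phi(A)$ for all $x\in\mathbb X$ and all measurable $A$. Let $r\ge 1$ be an integer. Then there is a constant $\alpha_1>0$ such that the following holds. Let $\pi$ be an invariant probability measure of $P$ and $F_P=\pi\otimes P$, i.e. $F_P(A\times B)=\int_A P(x,B)\,\pi(dx)$. Let $k:\mathbb X^2\times\mathbb X^2\to\mathbb R$ be a measurable positive definite kernel (symmetric, $\sum_{i,j}c_ic_jk(z_i,z_j)\ge 0$) with $|k|\le 1$, with reproducing kernel Hilbert space $\mathcal H_k$, and let $\mu_P=\int k(z,\cdot)\,F_P(dz)$. Let $(X_i)$ and $(Y_i)$ be independent stationary Markov chains on a common probability space, both with kernel $P$ and initial law $\pi$ (no change occurs, $Q=P$); here $(X_i)_{i\ge 1}$ is the reference data, and $(Y_t)_{t\ge -r}$ is the observed process. Put $\tilde X_i=(X_i,X_{i+1})$, $\tilde Y_i=(Y_i,Y_{i+1})$. Let $\Sigma_{\tilde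 X},\Sigma_{\tilde Y}$ be real numbers such that $\sum_{t=1}^n\rho_t\le\Sigma$ for all $n$, with $\Sigma=\Sigma_{\tilde X}$ and $\Sigma=\Sigma_{\tilde Y}$ respectively, where $\rho_t=\bigl|\mathbb E\langle k(Z_t,\cdot)-\mu_P,\,k(Z_0,\cdot)-\mu_P\rangle_{\mathcal H_k}\bigr|$ for the stationary pair process $(Z_t)$ in question ($\tilde X$, respectively $\tilde Y$, indexed from its first pair). Let $m\ge 1$ and $M,\tau\ge 0$ be integers. For $t\ge 0$ let $B_t=(Y_{t-r},\dots,Y_t)$ be the buffer at time $t$ and $$s(B_t)=\sqrt{\frac1{r^2}\sum_{i,j=t-r}^{t-1}k(\tilde Y_i,\tilde Y_j)+\frac1{m^2}\sum_{i,j=1}^{m}k(\tilde X_i,\tilde X_j)-\frac2{mr}\sum_{i=t-r}^{t-1}\sum_{j=1}^{m}k(\tilde Y_i,\tilde X_j)}-\sqrt{\frac{1+\Sigma_{\tilde X}}m}-\sqrt{\frac{1+\Sigma_{\tilde Y}}r},$$ $$S_{j:n}=\sum_{t=j}^{n}s(B_t),\qquad \hat S_n=\max_{1\le j\le n-M}S_{j:n}\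 \ (-\infty\text{ if } n\le M),\qquad T(b,M)=\inf\{n\in\mathbb N:\hat S_n\ge b\}\in\mathbb N\cup\{\infty\}.$$ Then the mean time between false alarms $\mathrm{MTBFA}(T)=\mathbb E[T-\tau\mid T>\tau]$ (for $\tau=0$ this is $\mathbb E[T]$) satisfies, for all sufficiently large $b$, $$\mathrm{MTBFA}(T(b,M))\ \ge\ M-1+(b-\alpha_1)(1+o(1)),$$ where $o(1)$ is a function of $b$ that tends to $0$ as $b\to\infty$ with all other data fixed. -/

import Mathlib

open MeasureTheory ProbabilityTheory Filter Topology
open scoped ENNReal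

noncomputable section

namespace KernelCusum

/-- Doeblin's condition: `P^l (x, ·) ≥ lam • φ` for all `x`, for some probability measure `φ`,
some `lam > 0` and some integer `l ≥ 1`. -/
def Doeblin {S : Type*} [MeasurableSpace S] (P : Kernel S S) : Prop :=
  ∃ (φ : Measure S) (lam : ℝ) (l : ℕ), IsProbabilityMeasure φ ∧ 0 < lam ∧ 1 ≤ l ∧
    ∀ x : S, ∀ A : Set S, MeasurableSet A → ENNReal.ofReal lam * φ A ≤ (P ^ l) x A

/-- `X` is a Markov chain (with respect to its own history) under `μ` with transition kernel `P`
and initial law `ν`: the joint law of `(X 0, …, X n)` and `X (n + 1)` is obtained by drawing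
`X (n + 1)` from `P (X n, ·)`. -/
structure IsMarkovChain {Ω S : Type*} [MeasurableSpace Ω] [MeasurableSpace S]
    (μ : Measure Ω) (P : Kernel S S) (ν : Measure S) (X : ℕ → Ω → S) : Prop where
  measurable : ∀ i, Measurable (X i)
  initial : μ.map (X 0) = ν
  step : ∀ n : ℕ,
    μ.map (fun ω => ((fun i : Fin (n + 1) => X i ω), X (n + 1) ω)) =
      (μ.map (fun ω => fun i : Fin (n + 1) => X i ω)) ⊗ₘ
        (P.comap (fun h : Fin (n + 1) → S => h (Fin.last n)) (measurable_pi_apply _))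

/-- The inner product `⟨k(x, ·) - μ_F, k(y, ·) - μ_F⟩` in the reproducing kernel Hilbert space of
`k`, where `μ_F = ∫ k(z, ·) dF(z)` is the mean embedding of `F`, expanded through the reproducing
property (see `inner_sub_embedding`). -/
def centeredKernel {Z : Type*} [MeasurableSpace Z] (k : Z → Z → ℝ) (F : Measure Z) (x y : Z) : ℝ :=
  k x y - (∫ z, k x z ∂F) - (∫ z, k z y ∂F) + ∫ z, ∫ w, k z w ∂F ∂F

/-- `centeredKernel` is the inner product of centered features, for every feature map `Φ` of `k`
into an inner product space and every mean embedding `e` of `F`. -/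
theorem inner_sub_embedding {Z H : Type*} [MeasurableSpace Z] [NormedAddCommGroup H]
    [InnerProductSpace ℝ H] (k : Z → Z → ℝ) (F : Measure Z) (Φ : Z → H) (e : H)
    (hΦ : ∀ x y, inner ℝ (Φ x) (Φ y) = k x y)
    (he : ∀ h : H, inner ℝ e h = ∫ z, inner ℝ (Φ z) h ∂F) (x y : Z) :
    inner ℝ (Φ x - e) (Φ y - e) = centeredKernel k F x y := by
  have h1 : inner ℝ (Φ x) e = ∫ z, k x z ∂F := by
    rw [real_inner_comm, he]
    exact integral_congr_ae (ae_of_all _ fun z => by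
      show inner ℝ (Φ z) (Φ x) = k x z
      rw [real_inner_comm, hΦ])
  have h2 : inner ℝ e (Φ y) = ∫ z, k z y ∂F := by
    rw [he]; simp only [hΦ]
  have h3 : inner ℝ e e = ∫ z, ∫ w, k z w ∂F ∂F := by
    rw [he]
    refine integral_congr_ae (ae_of_all _ fun z => ?_)
    show inner ℝ (Φ z) e = ∫ w, k z w ∂F
    rw [real_inner_comm, he]
    exact integral_congr_ae (ae_of_all _ fun w => by
      show inner ℝ (Φ w) (Φ z) = k z w
      rw [real_inner_comm, hΦ])
  rw [inner_sub_left, inner_sub_right, inner_sub_right, hΦ, h1, h2, h3, centeredKernel]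
  ring

/-- The weak dependence coefficient
`ρ_t = |E ⟨k(Z_t, ·) - μ_F, k(Z_0, ·) - μ_F⟩|` of a process `(Z_t)` with marginal law `F`. -/
def weakDep {Ω Z : Type*} [MeasurableSpace Ω] [MeasurableSpace Z] (μ : Measure Ω)
    (k : Z → Z → ℝ) (F : Measure Z) (Zt : ℕ → Ω → Z) (t : ℕ) : ℝ :=
  |∫ ω, centeredKernel k F (Zt t ω) (Zt 0 ω) ∂μ|

/-- The process is weakly dependent with constant `sig`: `ρ_1 + … + ρ_n ≤ sig` for all `n`. -/
def WeaklyDependent {Ω Z : Type*} [MeasurableSpace Ω] [MeasurableSpace Z] (μ : Measure Ω)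
    (k : Z → Z → ℝ) (F : Measure Z) (Zt : ℕ → Ω → Z) (sig : ℝ) : Prop :=
  ∀ n : ℕ, ∑ t ∈ Finset.Icc 1 n, weakDep μ k F Zt t ≤ sig

/-- The second order process `(X_i, X_{i+1})`. -/
def secondOrder {Ω S : Type*} (X : ℕ → Ω → S) (i : ℕ) (ω : Ω) : S × S := (X i ω, X (i + 1) ω)

/-- The `n` consecutive pairs contained in a block of `n + 1` observations. -/
def pairs {S : Type*} {n : ℕ} (B : Fin (n + 1) → S) (i : Fin n) : S × S :=
  (B i.castSucc, B i.succ)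

/-- The MMD `γ_k` between the empirical measures of two samples. -/
def empiricalMMD {Z : Type*} (k : Z → Z → ℝ) {r m : ℕ} (y : Fin r → Z) (x : Fin m → Z) : ℝ :=
  √((1 / (r : ℝ) ^ 2) * ∑ i, ∑ j, k (y i) (y j) + (1 / (m : ℝ) ^ 2) * ∑ i, ∑ j, k (x i) (x j)
    - (2 / ((m : ℝ) * (r : ℝ))) * ∑ i, ∑ j, k (y i) (x j))

/-- The estimation error bound subtracted from the empirical MMD. -/
def errorBound (m r : ℕ) (sigX sigY : ℝ) : ℝ := √((1 + sigX) / m) + √((1 + sigY) / r)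

/-- The score `s(B)` of a buffer `B` of `r + 1` observations, relative to the reference
block `x` of `m + 1` observations. -/
def score {S : Type*} (k : S × S → S × S → ℝ) (sigX sigY : ℝ) {m r : ℕ}
    (x : Fin (m + 1) → S) (B : Fin (r + 1) → S) : ℝ :=
  empiricalMMD k (pairs B) (pairs x) - errorBound m r sigX sigY

/-- The buffer at time `t` for an observed path `y`. The observations are numbered so that `y j` is
the one made at time `j - r`; hence the buffer holds the observations made at times `t - r, …, t`
and is already full at time `0`. -/
def buffer {S : Type*} (r : ℕ) (y : ℕ → S) (t : ℕ) : Fin (r + 1) → S := fun j => y (t + j)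

/-- `S_{k:n}`, the sum of the scores from time `k` to time `n`. -/
def cusum (s : ℕ → ℝ) (k n : ℕ) : ℝ := ∑ t ∈ Finset.Icc k n, s t

/-- `max_{1 ≤ k ≤ n - M} S_{k:n}`, equal to `-∞` if there is no such `k`, i.e. if `n ≤ M`. -/
def testStatistic (s : ℕ → ℝ) (M n : ℕ) : EReal :=
  ⨆ k ∈ Finset.Icc 1 (n - M), ((cusum s k n : ℝ) : EReal)

/-- The stopping time `T(b, M)`: the first `n` at which the test statistic reaches `b`
(`∞` if there is none). -/
def stoppingTime (s : ℕ → ℝ) (b : ℝ) (M : ℕ) : ℕ∞ :=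
  ⨅ (n : ℕ) (_ : (b : EReal) ≤ testStatistic s M n), (n : ℕ∞)

/-- The kernel CUSUM stopping time `T(b, M)` computed from the reference process `X` (of which the
first `m + 1` observations are used) and the observed process `Y`. -/
def kernelCusumTime {Ω S : Type*} (k : S × S → S × S → ℝ) (sigX sigY : ℝ) (m r : ℕ)
    (X Y : ℕ → Ω → S) (b : ℝ) (M : ℕ) (ω : Ω) : ℕ∞ :=
  stoppingTime
    (fun t => score k sigX sigY (fun i : Fin (m + 1) => X i ω) (buffer r (fun j => Y j ω) t)) b M

/-- The mean time between false alarms `E[T - τ | T > τ]`, for `μ` a law without change.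
For `τ = 0` and `T > 0` this is `E[T]`. -/
def mtbfa {Ω : Type*} [MeasurableSpace Ω] (μ : Measure Ω) (T : Ω → ℕ∞) (τ : ℕ) : ℝ≥0∞ :=
  ∫⁻ ω, ((T ω - (τ : ℕ∞) : ℕ∞) : ℝ≥0∞) ∂(ProbabilityTheory.cond μ {ω | (τ : ℕ∞) < T ω})

end KernelCusum

end

/-!
Let `D` be the empirical MMD and `e` the error bound, so that the score is `D - e`. The score may
have positive mean, but expanding `D ^ 2` and using stationarity, independence and weak dependence
gives `E[D ^ 2] ≤ 2 e ^ 2`, hence by AM-GM `E[(D - e)⁺] ≤ E[D ^ 2] / (4 e) ≤ e / 2`. An alarm by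
time `n` forces the positive parts of the first `n` scores to add up to `b`, which has probability
at most `n e / (2 b)`. If `e ≤ 1`, summing `P(T > n) ≥ 1 - n / (2 b)` over `n < 2 b` gives
`E[T] ≥ b`; if `e ≥ 1`, every score is at most `2 - e ≤ 1` because `D ≤ 2`, so `T ≥ b` surely.
As `T - τ` vanishes when `T ≤ τ`, conditioning on `T > τ` can only increase its mean, so the mean
time between false alarms is at least `b - τ`; the constants `M` and `τ` are absorbed by `o(1)`.
-/

namespace KernelCusum

section StoppingTime

variable {s : ℕ → ℝ} {b c : ℝ} {M n : ℕ}

theorem testStatistic_le_sum_max (s : ℕ → ℝ) (M n : ℕ) :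
    testStatistic s M n ≤ ((∑ t ∈ Finset.Icc 1 n, max (s t) 0 : ℝ) : EReal) := by
  refine iSup₂_le fun j hj => EReal.coe_le_coe_iff.2 ?_
  calc cusum s j n ≤ ∑ t ∈ Finset.Icc j n, max (s t) 0 :=
        Finset.sum_le_sum fun t _ => le_max_left (s t) 0
    _ ≤ ∑ t ∈ Finset.Icc 1 n, max (s t) 0 :=
        Finset.sum_le_sum_of_subset_of_nonneg
          (Finset.Icc_subset_Icc_left (Finset.mem_Icc.1 hj).1) fun t _ _ => le_max_right (s t) 0

theorem le_sum_max_of_stoppingTime_le (h : stoppingTime s b M ≤ n) :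
    b ≤ ∑ t ∈ Finset.Icc 1 n, max (s t) 0 := by
  have hlt : stoppingTime s b M < ((n + 1 : ℕ) : ℕ∞) :=
    h.trans_lt (by exact_mod_cast Nat.lt_succ_self n)
  obtain ⟨j, hj, hjn⟩ : ∃ j : ℕ, (b : EReal) ≤ testStatistic s M j ∧ j ≤ n := by
    simpa only [stoppingTime, iInf_lt_iff, exists_prop, Nat.cast_lt, Nat.lt_succ_iff] using hlt
  calc b ≤ ∑ t ∈ Finset.Icc 1 j, max (s t) 0 :=
        EReal.coe_le_coe_iff.1 (hj.trans (testStatistic_le_sum_max s M j))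
    _ ≤ ∑ t ∈ Finset.Icc 1 n, max (s t) 0 :=
        Finset.sum_le_sum_of_subset_of_nonneg (Finset.Icc_subset_Icc_right hjn)
          fun t _ _ => le_max_right (s t) 0

theorem ofReal_div_le_stoppingTime (hc : 0 < c) (hs : ∀ t, s t ≤ c) :
    ENNReal.ofReal (b / c) ≤ (stoppingTime s b M : ℝ≥0∞) := by
  cases h : stoppingTime s b M using ENat.recTopCoe with
  | top => simp
  | coe n =>
    have hbn : b ≤ n * c := by
      calc b ≤ ∑ t ∈ Finset.Icc 1 n, max (s t) 0 := le_sum_max_of_stoppingTime_le h.le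
        _ ≤ ∑ _t ∈ Finset.Icc 1 n, c := Finset.sum_le_sum fun t _ => max_le (hs t) hc.le
        _ = n * c := by simp
    rw [ENat.toENNReal_coe, ← ENNReal.ofReal_natCast]
    exact ENNReal.ofReal_le_ofReal ((div_le_iff₀ hc).2 hbn)

/-- Markov's inequality for the event of an alarm by time `n`, before taking expectations and
summed over `n`. -/
theorem ofReal_sum_one_sub_le_stoppingTime (hb : 0 < b) (N : ℕ) :
    ENNReal.ofReal (∑ n ∈ Finset.range N, (1 - (∑ t ∈ Finset.Icc 1 n, max (s t) 0) / b)) ≤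
      (stoppingTime s b M : ℝ≥0∞) := by
  cases h : stoppingTime s b M using ENat.recTopCoe with
  | top => simp
  | coe T =>
    have hterm (n : ℕ) :
        1 - (∑ t ∈ Finset.Icc 1 n, max (s t) 0) / b ≤ if n < T then (1 : ℝ) else 0 := by
      split_ifs with hn
      · exact sub_le_self 1 (div_nonneg (Finset.sum_nonneg fun t _ => le_max_right (s t) 0) hb.le)
      · have hTn : stoppingTime s b M ≤ n := h.trans_le (by exact_mod_cast not_lt.1 hn)
        exact sub_nonpos.2 ((one_le_div hb).2 (le_sum_max_of_stoppingTime_le hTn))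
    have hcard : (Finset.range N).filter (· < T) ⊆ Finset.range T := fun n hn =>
      Finset.mem_range.2 (Finset.mem_filter.1 hn).2
    rw [ENat.toENNReal_coe, ← ENNReal.ofReal_natCast]
    refine ENNReal.ofReal_le_ofReal ?_
    calc ∑ n ∈ Finset.range N, (1 - (∑ t ∈ Finset.Icc 1 n, max (s t) 0) / b)
        ≤ ∑ n ∈ Finset.range N, if n < T then (1 : ℝ) else 0 :=
          Finset.sum_le_sum fun n _ => hterm n
      _ = ((Finset.range N).filter (· < T)).card := by simp
      _ ≤ T := by exact_mod_cast (Finset.card_le_card hcard).trans_eq (Finset.card_range T)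

end StoppingTime

section MeanStoppingTime

variable {Ω : Type*} [MeasurableSpace Ω] {μ : Measure Ω}

theorem half_add_one_le_sum_one_sub_div {x : ℝ} (hx : 0 < x) :
    (x + 1) / 2 ≤ ∑ n ∈ Finset.range ⌈x⌉₊, (1 - n / x) := by
  have hsum (N : ℕ) : ∑ n ∈ Finset.range N, (1 - n / x) = N * (2 * x + 1 - N) / (2 * x) := by
    induction N with
    | zero => simp
    | succ N ih =>
      rw [Finset.sum_range_succ, ih]
      push_cast
      field_simp
      ring
  have hle : x ≤ ⌈x⌉₊ := Nat.le_ceil x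
  have hlt : (⌈x⌉₊ : ℝ) < x + 1 := Nat.ceil_lt_add_one hx.le
  rw [hsum, le_div_iff₀ (by positivity)]
  linarith [mul_nonneg (sub_nonneg.2 hle) (sub_nonneg.2 hlt.le)]

theorem ofReal_integral_le_lintegral_ofReal (f : Ω → ℝ) :
    ENNReal.ofReal (∫ ω, f ω ∂μ) ≤ ∫⁻ ω, ENNReal.ofReal (f ω) ∂μ := by
  by_cases hf : Integrable f μ
  · rw [integral_eq_lintegral_pos_part_sub_lintegral_neg_part hf]
    exact (ENNReal.ofReal_le_ofReal (sub_le_self _ ENNReal.toReal_nonneg)).trans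
      ENNReal.ofReal_toReal_le
  · simp [integral_undef hf]

theorem ofReal_le_lintegral_stoppingTime [IsProbabilityMeasure μ] {s : ℕ → Ω → ℝ} {b c : ℝ}
    (hint : ∀ t, Integrable (s t) μ) (hs : ∀ t, ∫ ω, max (s t ω) 0 ∂μ ≤ c)
    (hb : 0 < b) (hc : 0 < c) (M : ℕ) :
    ENNReal.ofReal ((b / c + 1) / 2) ≤
      ∫⁻ ω, (stoppingTime (fun t => s t ω) b M : ℝ≥0∞) ∂μ := by
  let A (n : ℕ) (ω : Ω) : ℝ := ∑ t ∈ Finset.Icc 1 n, max (s t ω) 0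
  have hA (n : ℕ) : Integrable (fun ω => A n ω / b) μ :=
    (integrable_finsetSum _ fun t _ => (hint t).pos_part).div_const b
  have hA' (n : ℕ) : Integrable (fun ω => 1 - A n ω / b) μ := (integrable_const 1).sub (hA n)
  have hmean (n : ℕ) : 1 - n / (b / c) ≤ ∫ ω, (1 - A n ω / b) ∂μ := by
    have hAn : ∫ ω, A n ω ∂μ ≤ n * c := by
      calc ∫ ω, A n ω ∂μ = ∑ t ∈ Finset.Icc 1 n, ∫ ω, max (s t ω) 0 ∂μ :=
            integral_finsetSum _ fun t _ => (hint t).pos_part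
        _ ≤ ∑ _t ∈ Finset.Icc 1 n, c := Finset.sum_le_sum fun t _ => hs t
        _ = n * c := by simp
    rw [integral_sub (integrable_const 1) (hA n), integral_div, integral_const, probReal_univ,
      one_smul, div_div_eq_mul_div]
    gcongr
  calc ENNReal.ofReal ((b / c + 1) / 2)
      ≤ ENNReal.ofReal (∑ n ∈ Finset.range ⌈b / c⌉₊, ∫ ω, (1 - A n ω / b) ∂μ) :=
        ENNReal.ofReal_le_ofReal <| (half_add_one_le_sum_one_sub_div (div_pos hb hc)).trans <|
          Finset.sum_le_sum fun n _ => hmean n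
    _ = ENNReal.ofReal (∫ ω, ∑ n ∈ Finset.range ⌈b / c⌉₊, (1 - A n ω / b) ∂μ) := by
        rw [integral_finsetSum _ fun n _ => hA' n]
    _ ≤ ∫⁻ ω, (stoppingTime (fun t => s t ω) b M : ℝ≥0∞) ∂μ :=
        (ofReal_integral_le_lintegral_ofReal _).trans <|
          lintegral_mono fun ω => ofReal_sum_one_sub_le_stoppingTime hb _

theorem lintegral_sub_le_mtbfa [IsProbabilityMeasure μ] (T : Ω → ℕ∞) (τ : ℕ) :
    ∫⁻ ω, (T ω : ℝ≥0∞) ∂μ - τ ≤ mtbfa μ T τ := by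
  have hsupp : Function.support (fun ω => ((T ω - (τ : ℕ∞) : ℕ∞) : ℝ≥0∞)) ⊆
      {ω | (τ : ℕ∞) < T ω} := fun ω hω => by
    by_contra hle
    have hzero : T ω - τ = 0 := tsub_eq_zero_of_le (not_lt.1 (Set.notMem_ofPred_iff.1 hle))
    exact hω (by simp only [hzero, ENat.toENNReal_zero])
  calc ∫⁻ ω, (T ω : ℝ≥0∞) ∂μ - τ
      = ∫⁻ ω, (T ω : ℝ≥0∞) ∂μ - ∫⁻ _, (τ : ℝ≥0∞) ∂μ := by simp
    _ ≤ ∫⁻ ω, ((T ω - (τ : ℕ∞) : ℕ∞) : ℝ≥0∞) ∂μ := by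
        simpa only [ENat.toENNReal_sub, ENat.toENNReal_coe] using
          lintegral_sub_le (fun _ => (τ : ℝ≥0∞)) (fun ω => (T ω : ℝ≥0∞)) measurable_const
    _ ≤ (μ {ω | (τ : ℕ∞) < T ω})⁻¹ * ∫⁻ ω, ((T ω - (τ : ℕ∞) : ℕ∞) : ℝ≥0∞) ∂μ :=
        le_mul_of_one_le_left' (ENNReal.one_le_inv.2 prob_le_one)
    _ = mtbfa μ T τ := by
        rw [mtbfa, ProbabilityTheory.cond, lintegral_smul_measure,
          setLIntegral_eq_of_support_subset hsupp, smul_eq_mul]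

end MeanStoppingTime

section EmpiricalMMD

variable {Z ι κ : Type*} [Fintype ι] [Fintype κ] {k : Z → Z → ℝ}

/-- The average of the kernel `k` over all pairs consisting of a point of `y` and a point of `x`,
that is, the inner product of the empirical mean embeddings of the two samples. It is `0` if one
of the samples is empty. -/
noncomputable def kernelAverage (k : Z → Z → ℝ) (y : ι → Z) (x : κ → Z) : ℝ :=
  (∑ i, ∑ j, k (y i) (x j)) / (Fintype.card ι * Fintype.card κ)

/-- The square of the MMD between the empirical measures of two samples, with the inner products
of the empirical mean embeddings expanded. It is the radicand in `empiricalMMD`. -/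
noncomputable def sqMMD (k : Z → Z → ℝ) (y : ι → Z) (x : κ → Z) : ℝ :=
  kernelAverage k y y + kernelAverage k x x - 2 * kernelAverage k y x

theorem empiricalMMD_eq_sqrt_sqMMD {r m : ℕ} (y : Fin r → Z) (x : Fin m → Z) :
    empiricalMMD k y x = √(sqMMD k y x) := by
  simp only [empiricalMMD, sqMMD, kernelAverage, Fintype.card_fin]
  congr 1
  ring

theorem kernel_comm (hk : (Matrix.of k).PosSemidef) (z w : Z) : k z w = k w z := by
  simpa using hk.isHermitian.apply w z

theorem sqMMD_nonneg (hk : (Matrix.of k).PosSemidef) (y : ι → Z) (x : κ → Z) :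
    0 ≤ sqMMD k y x := by
  have hcomm : ∑ i, ∑ j, k (x i) (y j) = ∑ i, ∑ j, k (y i) (x j) := by
    simp only [Finset.sum_comm (s := (Finset.univ : Finset κ)), kernel_comm hk (x _)]
  -- The quadratic form of `k` at the difference of the empirical measures of `y` and `x`.
  have hquad := (hk.submatrix (Sum.elim y x)).dotProduct_mulVec_nonneg
    (Sum.elim (fun _ => 1 / (Fintype.card ι : ℝ)) fun _ => -(1 / (Fintype.card κ : ℝ)))
  simp only [dotProduct, Matrix.mulVec, Fintype.sum_sum_type, Sum.elim_inl, Sum.elim_inr,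
    Matrix.submatrix_apply, Matrix.of_apply, Pi.star_apply, star_trivial, mul_add,
    Finset.sum_add_distrib, ← Finset.mul_sum, ← Finset.sum_mul, hcomm] at hquad
  refine hquad.trans_eq ?_
  unfold sqMMD kernelAverage
  ring

theorem abs_kernelAverage_le_one (hk : ∀ z w, |k z w| ≤ 1) (y : ι → Z) (x : κ → Z) :
    |kernelAverage k y x| ≤ 1 := by
  have hsum : |∑ i, ∑ j, k (y i) (x j)| ≤ Fintype.card ι * Fintype.card κ := by
    calc |∑ i, ∑ j, k (y i) (x j)| ≤ ∑ i, ∑ j, |k (y i) (x j)| :=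
          (Finset.abs_sum_le_sum_abs _ _).trans
            (Finset.sum_le_sum fun i _ => Finset.abs_sum_le_sum_abs _ _)
      _ ≤ ∑ _i : ι, ∑ _j : κ, (1 : ℝ) :=
          Finset.sum_le_sum fun i _ => Finset.sum_le_sum fun j _ => hk _ _
      _ = Fintype.card ι * Fintype.card κ := by simp
  rw [kernelAverage, abs_div, abs_of_nonneg (by positivity : (0 : ℝ) ≤ _ * _)]
  exact div_le_one_of_le₀ hsum (by positivity)

theorem sqMMD_le_four (hk : ∀ z w, |k z w| ≤ 1) (y : ι → Z) (x : κ → Z) : sqMMD k y x ≤ 4 := by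
  have hyy := (abs_le.1 (abs_kernelAverage_le_one hk y y)).2
  have hxx := (abs_le.1 (abs_kernelAverage_le_one hk x x)).2
  have hyx := (abs_le.1 (abs_kernelAverage_le_one hk y x)).1
  unfold sqMMD
  linarith

theorem empiricalMMD_le_two (hk : ∀ z w, |k z w| ≤ 1) {r m : ℕ} (y : Fin r → Z)
    (x : Fin m → Z) : empiricalMMD k y x ≤ 2 := by
  rw [empiricalMMD_eq_sqrt_sqMMD, Real.sqrt_le_left zero_le_two]
  linarith [sqMMD_le_four hk y x]

end EmpiricalMMD

section ErrorBound

variable {m r : ℕ} {sigX sigY : ℝ}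

theorem errorBound_pos (hm : 1 ≤ m) (hX : 0 ≤ sigX) : 0 < errorBound m r sigX sigY :=
  add_pos_of_pos_of_nonneg (Real.sqrt_pos.2 (by positivity)) (Real.sqrt_nonneg _)

theorem add_le_errorBound_sq (hX : 0 ≤ sigX) (hY : 0 ≤ sigY) :
    (1 + sigY) / r + (1 + sigX) / m ≤ errorBound m r sigX sigY ^ 2 := by
  have hcross := mul_nonneg (Real.sqrt_nonneg ((1 + sigX) / m)) (Real.sqrt_nonneg ((1 + sigY) / r))
  rw [errorBound, add_sq, Real.sq_sqrt (by positivity), Real.sq_sqrt (by positivity)]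
  linarith

theorem max_sqrt_sub_le_div {q e : ℝ} (hq : 0 ≤ q) (he : 0 < e) :
    max (√q - e) 0 ≤ q / (4 * e) := by
  refine max_le ?_ (by positivity)
  rw [le_div_iff₀ (by positivity)]
  linarith [sq_nonneg (√q - 2 * e), Real.sq_sqrt hq]

end ErrorBound

section KernelIntegrals

theorem abs_integral_le_one {Ω : Type*} [MeasurableSpace Ω] {μ : Measure Ω}
    [IsProbabilityMeasure μ] {f : Ω → ℝ} (hf : ∀ ω, |f ω| ≤ 1) : |∫ ω, f ω ∂μ| ≤ 1 := by
  simpa using norm_integral_le_of_norm_le_const (μ := μ) (f := f) (C := 1) (ae_of_all _ hf)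

variable {Ω Z : Type*} [MeasurableSpace Ω] [MeasurableSpace Z] {μ : Measure Ω}
  [IsProbabilityMeasure μ] {k : Z → Z → ℝ} {F : Measure Z} [IsProbabilityMeasure F]
  {U V : Ω → Z}

/-- The squared norm `‖μ_F‖² = ∬ k dF dF` of the mean embedding of `F` in the reproducing kernel
Hilbert space of `k`. -/
noncomputable def sqNormEmbedding (k : Z → Z → ℝ) (F : Measure Z) : ℝ :=
  ∫ z, ∫ w, k z w ∂F ∂F

theorem integrable_kernel_comp (hkm : Measurable (Function.uncurry k))
    (hkb : ∀ z w, |k z w| ≤ 1) (hU : Measurable U) (hV : Measurable V) :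
    Integrable (fun ω => k (U ω) (V ω)) μ :=
  .of_bound (C := 1) (hkm.comp (hU.prodMk hV)).aestronglyMeasurable (ae_of_all _ fun _ => hkb _ _)

theorem integral_centeredKernel_comp (hkm : Measurable (Function.uncurry k))
    (hk : (Matrix.of k).PosSemidef) (hkb : ∀ z w, |k z w| ≤ 1) (hU : Measurable U)
    (hV : Measurable V) (hUF : μ.map U = F) (hVF : μ.map V = F) :
    ∫ ω, centeredKernel k F (U ω) (V ω) ∂μ =
      ∫ ω, k (U ω) (V ω) ∂μ - sqNormEmbedding k F := by
  have hmeas : Measurable fun z => ∫ w, k z w ∂F :=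
    (hkm.stronglyMeasurable.integral_prod_right (ν := F)).measurable
  have hint {W : Ω → Z} (hW : Measurable W) : Integrable (fun ω => ∫ w, k (W ω) w ∂F) μ :=
    .of_bound (C := 1) (hmeas.comp hW).aestronglyMeasurable
      (ae_of_all _ fun ω => abs_integral_le_one (hkb (W ω)))
  have hmean {W : Ω → Z} (hW : Measurable W) (hWF : μ.map W = F) :
      ∫ ω, ∫ w, k (W ω) w ∂F ∂μ = sqNormEmbedding k F := by
    rw [sqNormEmbedding, ← integral_map (f := fun z => ∫ w, k z w ∂F) hW.aemeasurable
      hmeas.aestronglyMeasurable, hWF]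
  have hcomm (v : Z) : ∫ z, k z v ∂F = ∫ w, k v w ∂F := by simp only [kernel_comm hk v]
  have hkUV := integrable_kernel_comp (μ := μ) hkm hkb hU hV
  calc ∫ ω, centeredKernel k F (U ω) (V ω) ∂μ
      = ∫ ω, (k (U ω) (V ω) - ∫ w, k (U ω) w ∂F - ∫ w, k (V ω) w ∂F + sqNormEmbedding k F) ∂μ := by
        simp only [centeredKernel, hcomm, sqNormEmbedding]
    _ = ∫ ω, k (U ω) (V ω) ∂μ - sqNormEmbedding k F - sqNormEmbedding k F
          + sqNormEmbedding k F := by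
        rw [integral_add (by exact (hkUV.sub (hint hU)).sub (hint hV)) (integrable_const _),
          integral_sub (by exact hkUV.sub (hint hU)) (hint hV), integral_sub hkUV (hint hU),
          hmean hU hUF, hmean hV hVF, integral_const, probReal_univ, one_smul]
    _ = ∫ ω, k (U ω) (V ω) ∂μ - sqNormEmbedding k F := by ring

theorem integral_kernel_comp_of_indepFun (hkm : Measurable (Function.uncurry k))
    (hkb : ∀ z w, |k z w| ≤ 1) (hU : Measurable U) (hV : Measurable V)
    (hUF : μ.map U = F) (hVF : μ.map V = F) (hUV : IndepFun U V μ) :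
    ∫ ω, k (U ω) (V ω) ∂μ = sqNormEmbedding k F := by
  have hlaw : μ.map (fun ω => (U ω, V ω)) = F.prod F := by
    rw [(indepFun_iff_map_prod_eq_prod_map_map hU.aemeasurable hV.aemeasurable).1 hUV, hUF, hVF]
  calc ∫ ω, k (U ω) (V ω) ∂μ = ∫ p, Function.uncurry k p ∂(F.prod F) := by
        rw [← hlaw, integral_map (hU.prodMk hV).aemeasurable hkm.aestronglyMeasurable]
        rfl
    _ = sqNormEmbedding k F :=
        integral_prod _ (integrable_kernel_comp hkm hkb measurable_fst measurable_snd)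

end KernelIntegrals

section KernelAverageIntegrals

variable {Ω Z ι κ : Type*} [MeasurableSpace Ω] [MeasurableSpace Z] [Fintype ι] [Fintype κ]
  {μ : Measure Ω} [IsProbabilityMeasure μ] {k : Z → Z → ℝ} {F : Measure Z}
  {U : ι → Ω → Z} {V : κ → Ω → Z}

theorem integrable_kernelAverage (hkm : Measurable (Function.uncurry k))
    (hkb : ∀ z w, |k z w| ≤ 1) (hU : ∀ i, Measurable (U i)) (hV : ∀ j, Measurable (V j)) :
    Integrable (fun ω => kernelAverage k (U · ω) (V · ω)) μ :=
  (integrable_finsetSum _ fun i _ => integrable_finsetSum _ fun j _ =>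
    integrable_kernel_comp hkm hkb (hU i) (hV j)).div_const _

theorem integral_kernelAverage (hkm : Measurable (Function.uncurry k))
    (hkb : ∀ z w, |k z w| ≤ 1) (hU : ∀ i, Measurable (U i)) (hV : ∀ j, Measurable (V j)) :
    ∫ ω, kernelAverage k (U · ω) (V · ω) ∂μ =
      (∑ i, ∑ j, ∫ ω, k (U i ω) (V j ω) ∂μ) / (Fintype.card ι * Fintype.card κ) := by
  have hint (i : ι) (j : κ) := integrable_kernel_comp (μ := μ) hkm hkb (hU i) (hV j)
  simp only [kernelAverage]
  rw [integral_div, integral_finsetSum _ fun i _ => integrable_finsetSum _ fun j _ => hint i j]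
  simp only [integral_finsetSum _ fun j _ => hint _ j]

theorem integral_kernelAverage_of_indepFun [Nonempty ι] [Nonempty κ] [IsProbabilityMeasure F]
    (hkm : Measurable (Function.uncurry k)) (hkb : ∀ z w, |k z w| ≤ 1)
    (hU : ∀ i, Measurable (U i)) (hV : ∀ j, Measurable (V j)) (hUF : ∀ i, μ.map (U i) = F)
    (hVF : ∀ j, μ.map (V j) = F) (hUV : ∀ i j, IndepFun (U i) (V j) μ) :
    ∫ ω, kernelAverage k (U · ω) (V · ω) ∂μ = sqNormEmbedding k F := by
  have hterm (i : ι) (j : κ) : ∫ ω, k (U i ω) (V j ω) ∂μ = sqNormEmbedding k F :=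
    integral_kernel_comp_of_indepFun hkm hkb (hU i) (hV j) (hUF i) (hVF j) (hUV i j)
  rw [integral_kernelAverage hkm hkb hU hV]
  simp only [hterm, Finset.sum_const, Finset.card_univ, nsmul_eq_mul]
  field_simp

theorem integrable_sqMMD (hkm : Measurable (Function.uncurry k))
    (hkb : ∀ z w, |k z w| ≤ 1) (hU : ∀ i, Measurable (U i)) (hV : ∀ j, Measurable (V j)) :
    Integrable (fun ω => sqMMD k (U · ω) (V · ω)) μ :=
  ((integrable_kernelAverage hkm hkb hU hU).add (integrable_kernelAverage hkm hkb hV hV)).sub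
    ((integrable_kernelAverage hkm hkb hU hV).const_mul 2)

theorem integral_sqMMD (hkm : Measurable (Function.uncurry k))
    (hkb : ∀ z w, |k z w| ≤ 1) (hU : ∀ i, Measurable (U i)) (hV : ∀ j, Measurable (V j)) :
    ∫ ω, sqMMD k (U · ω) (V · ω) ∂μ =
      ∫ ω, kernelAverage k (U · ω) (U · ω) ∂μ + ∫ ω, kernelAverage k (V · ω) (V · ω) ∂μ
        - 2 * ∫ ω, kernelAverage k (U · ω) (V · ω) ∂μ := by
  have hUU := integrable_kernelAverage (μ := μ) hkm hkb hU hU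
  have hVV := integrable_kernelAverage (μ := μ) hkm hkb hV hV
  have hUV := integrable_kernelAverage (μ := μ) hkm hkb hU hV
  simp only [sqMMD]
  rw [integral_sub (by exact hUU.add hVV) (hUV.const_mul 2), integral_add hUU hVV,
    integral_const_mul]

theorem integrable_empiricalMMD {r m : ℕ} {U : Fin r → Ω → Z} {V : Fin m → Ω → Z}
    (hkm : Measurable (Function.uncurry k)) (hkb : ∀ z w, |k z w| ≤ 1)
    (hU : ∀ i, Measurable (U i)) (hV : ∀ j, Measurable (V j)) :
    Integrable (fun ω => empiricalMMD k (U · ω) (V · ω)) μ := by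
  have hmeas : AEStronglyMeasurable (fun ω => empiricalMMD k (U · ω) (V · ω)) μ := by
    simp only [empiricalMMD_eq_sqrt_sqMMD]
    exact Real.continuous_sqrt.comp_aestronglyMeasurable
      (integrable_sqMMD hkm hkb hU hV).aestronglyMeasurable
  refine .of_bound (C := 2) hmeas (ae_of_all _ fun ω => ?_)
  rw [Real.norm_of_nonneg (by exact Real.sqrt_nonneg _)]
  exact empiricalMMD_le_two hkb _ _

end KernelAverageIntegrals

/-- A process with marginal law `F` that is stationary as far as pairs of terms are concerned: the
joint law of two terms depends only on their lag. The squared MMD involves no more than two terms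
at a time, so its mean requires no stronger form of stationarity. -/
structure IsLagStationary {Ω Z : Type*} [MeasurableSpace Ω] [MeasurableSpace Z] (μ : Measure Ω)
    (F : Measure Z) (Zt : ℕ → Ω → Z) : Prop where
  measurable : ∀ i, Measurable (Zt i)
  map_eq : ∀ i, μ.map (Zt i) = F
  identDistrib_pair : ∀ i t,
    IdentDistrib (fun ω => (Zt (i + t) ω, Zt i ω)) (fun ω => (Zt t ω, Zt 0 ω)) μ μ

section WeakDependence

variable {Ω Z : Type*} [MeasurableSpace Ω] [MeasurableSpace Z] {μ : Measure Ω}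
  {k : Z → Z → ℝ} {F : Measure Z} {U V : ℕ → Ω → Z} {sig sigU sigV : ℝ}

theorem WeaklyDependent.nonneg (h : WeaklyDependent μ k F U sig) : 0 ≤ sig := by
  simpa using h 0

theorem sum_range_dist_le {ρ : ℕ → ℝ} (hρ : ∀ n, ∑ t ∈ Finset.Icc 1 n, ρ t ≤ sig) {n i : ℕ}
    (hi : i < n) : ∑ j ∈ Finset.range n, ρ (Nat.dist i j) ≤ ρ 0 + 2 * sig := by
  have hshift (n : ℕ) : ∑ t ∈ Finset.range n, ρ (t + 1) ≤ sig := by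
    rw [Finset.range_eq_Ico, Finset.sum_Ico_add' ρ 0 n 1]
    exact hρ n
  have hbelow : ∑ j ∈ Finset.range i, ρ (Nat.dist i j) = ∑ t ∈ Finset.range i, ρ (t + 1) := by
    rw [← Finset.sum_range_reflect]
    refine Finset.sum_congr rfl fun t ht => congrArg ρ ?_
    have := Finset.mem_range.1 ht
    unfold Nat.dist
    omega
  obtain ⟨l, rfl⟩ : ∃ l, n = i + (l + 1) := ⟨n - i - 1, by omega⟩
  have habove : ∑ t ∈ Finset.range (l + 1), ρ (Nat.dist i (i + t)) =
      ∑ t ∈ Finset.range l, ρ (t + 1) + ρ 0 := by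
    simp [Nat.dist, Finset.sum_range_succ']
  rw [Finset.sum_range_add, hbelow, habove]
  linarith [hshift i, hshift l]

namespace IsLagStationary

theorem shift (hU : IsLagStationary μ F U) (a : ℕ) :
    IsLagStationary μ F fun i => U (a + i) where
  measurable i := hU.measurable (a + i)
  map_eq i := hU.map_eq (a + i)
  identDistrib_pair i t := by
    simpa only [add_assoc, add_zero] using
      (hU.identDistrib_pair (a + i) t).trans (hU.identDistrib_pair a t).symm

theorem integral_kernel_lag (hU : IsLagStationary μ F U) (hkm : Measurable (Function.uncurry k))
    (i t : ℕ) : ∫ ω, k (U (i + t) ω) (U i ω) ∂μ = ∫ ω, k (U t ω) (U 0 ω) ∂μ :=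
  ((hU.identDistrib_pair i t).comp hkm).integral_eq

variable [IsProbabilityMeasure μ] [IsProbabilityMeasure F]

theorem weakDep_eq (hU : IsLagStationary μ F U) (hkm : Measurable (Function.uncurry k))
    (hk : (Matrix.of k).PosSemidef) (hkb : ∀ z w, |k z w| ≤ 1) (t : ℕ) :
    weakDep μ k F U t = |∫ ω, k (U t ω) (U 0 ω) ∂μ - sqNormEmbedding k F| := by
  rw [weakDep, integral_centeredKernel_comp hkm hk hkb (hU.measurable t) (hU.measurable 0)
    (hU.map_eq t) (hU.map_eq 0)]

theorem weaklyDependent_shift (hU : IsLagStationary μ F U)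
    (hkm : Measurable (Function.uncurry k)) (hk : (Matrix.of k).PosSemidef)
    (hkb : ∀ z w, |k z w| ≤ 1) (hsig : WeaklyDependent μ k F U sig) (a : ℕ) :
    WeaklyDependent μ k F (fun i => U (a + i)) sig := by
  have hweakDep (t : ℕ) : weakDep μ k F (fun i => U (a + i)) t = weakDep μ k F U t := by
    rw [(hU.shift a).weakDep_eq hkm hk hkb, hU.weakDep_eq hkm hk hkb]
    simp only [add_zero, hU.integral_kernel_lag hkm]
  simpa only [WeaklyDependent, hweakDep] using hsig

theorem weakDep_zero_le_two (hU : IsLagStationary μ F U)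
    (hkm : Measurable (Function.uncurry k)) (hk : (Matrix.of k).PosSemidef)
    (hkb : ∀ z w, |k z w| ≤ 1) : weakDep μ k F U 0 ≤ 2 := by
  have hvar : |∫ ω, k (U 0 ω) (U 0 ω) ∂μ| ≤ 1 := abs_integral_le_one fun ω => hkb _ _
  have hC : |sqNormEmbedding k F| ≤ 1 := abs_integral_le_one fun z => abs_integral_le_one (hkb z)
  rw [hU.weakDep_eq hkm hk hkb]
  linarith [abs_sub (∫ ω, k (U 0 ω) (U 0 ω) ∂μ) (sqNormEmbedding k F)]

theorem integral_kernel_le (hU : IsLagStationary μ F U) (hkm : Measurable (Function.uncurry k))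
    (hk : (Matrix.of k).PosSemidef) (hkb : ∀ z w, |k z w| ≤ 1) (i j : ℕ) :
    ∫ ω, k (U i ω) (U j ω) ∂μ ≤ sqNormEmbedding k F + weakDep μ k F U (Nat.dist i j) := by
  wlog hji : j ≤ i generalizing i j
  · simpa only [kernel_comm hk (U i _), Nat.dist_comm i] using this j i (not_le.1 hji).le
  obtain ⟨t, rfl⟩ := Nat.exists_eq_add_of_le hji
  have hdist : Nat.dist (j + t) j = t := by simp [Nat.dist]
  rw [hdist, hU.integral_kernel_lag hkm, hU.weakDep_eq hkm hk hkb]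
  linarith [le_abs_self (∫ ω, k (U t ω) (U 0 ω) ∂μ - sqNormEmbedding k F)]

theorem integral_kernelAverage_self_le (hU : IsLagStationary μ F U)
    (hkm : Measurable (Function.uncurry k)) (hk : (Matrix.of k).PosSemidef)
    (hkb : ∀ z w, |k z w| ≤ 1) (hsig : WeaklyDependent μ k F U sig) {n : ℕ} (hn : 1 ≤ n) :
    ∫ ω, kernelAverage k (fun i : Fin n => U i ω) (fun i : Fin n => U i ω) ∂μ ≤
      sqNormEmbedding k F + 2 * ((1 + sig) / n) := by
  have : (0 : ℝ) < n := by exact_mod_cast hn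
  have hrow (i : Fin n) : ∑ j : Fin n, ∫ ω, k (U i ω) (U j ω) ∂μ ≤
      n * sqNormEmbedding k F + 2 * (1 + sig) := by
    calc ∑ j : Fin n, ∫ ω, k (U i ω) (U j ω) ∂μ
        ≤ ∑ j : Fin n, (sqNormEmbedding k F + weakDep μ k F U (Nat.dist i j)) :=
          Finset.sum_le_sum fun j _ => hU.integral_kernel_le hkm hk hkb i j
      _ = n * sqNormEmbedding k F
            + ∑ j ∈ Finset.range n, weakDep μ k F U (Nat.dist i j) := by
          rw [Fin.sum_univ_eq_sum_range
            (fun j => sqNormEmbedding k F + weakDep μ k F U (Nat.dist i j)) n]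
          simp [Finset.sum_add_distrib]
      _ ≤ n * sqNormEmbedding k F + 2 * (1 + sig) := by
          linarith [sum_range_dist_le hsig i.2, hU.weakDep_zero_le_two hkm hk hkb]
  have hUm (i : Fin n) : Measurable (U i) := hU.measurable i
  rw [integral_kernelAverage hkm hkb hUm hUm, Fintype.card_fin, div_le_iff₀ (by positivity)]
  calc ∑ i : Fin n, ∑ j : Fin n, ∫ ω, k (U i ω) (U j ω) ∂μ
      ≤ ∑ _i : Fin n, (n * sqNormEmbedding k F + 2 * (1 + sig)) :=
        Finset.sum_le_sum fun i _ => hrow i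
    _ = (sqNormEmbedding k F + 2 * ((1 + sig) / n)) * (n * n) := by
        simp only [Finset.sum_const, Finset.card_univ, Fintype.card_fin, nsmul_eq_mul]
        field_simp

theorem integral_sqMMD_le (hU : IsLagStationary μ F U) (hV : IsLagStationary μ F V)
    (hkm : Measurable (Function.uncurry k)) (hk : (Matrix.of k).PosSemidef)
    (hkb : ∀ z w, |k z w| ≤ 1) (hUV : ∀ i j, IndepFun (U i) (V j) μ)
    (hsigU : WeaklyDependent μ k F U sigU) (hsigV : WeaklyDependent μ k F V sigV)
    {r m : ℕ} (hr : 1 ≤ r) (hm : 1 ≤ m) :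
    ∫ ω, sqMMD k (fun i : Fin r => U i ω) (fun j : Fin m => V j ω) ∂μ ≤
      2 * ((1 + sigU) / r + (1 + sigV) / m) := by
  have hUm (i : Fin r) : Measurable (U i) := hU.measurable i
  have hVm (j : Fin m) : Measurable (V j) := hV.measurable j
  have : NeZero r := ⟨by omega⟩
  have : NeZero m := ⟨by omega⟩
  have hcross : ∫ ω, kernelAverage k (fun i : Fin r => U i ω) (fun j : Fin m => V j ω) ∂μ =
      sqNormEmbedding k F :=
    integral_kernelAverage_of_indepFun hkm hkb hUm hVm (fun i => hU.map_eq i)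
      (fun j => hV.map_eq j) fun i j => hUV i j
  rw [integral_sqMMD hkm hkb hUm hVm, hcross]
  linarith [hU.integral_kernelAverage_self_le hkm hk hkb hsigU hr,
    hV.integral_kernelAverage_self_le hkm hk hkb hsigV hm]

theorem integral_max_empiricalMMD_sub_errorBound_le (hU : IsLagStationary μ F U)
    (hV : IsLagStationary μ F V) (hkm : Measurable (Function.uncurry k))
    (hk : (Matrix.of k).PosSemidef) (hkb : ∀ z w, |k z w| ≤ 1)
    (hUV : ∀ i j, IndepFun (U i) (V j) μ) (hsigU : WeaklyDependent μ k F U sigU)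
    (hsigV : WeaklyDependent μ k F V sigV) {r m : ℕ} (hr : 1 ≤ r) (hm : 1 ≤ m) :
    ∫ ω, max (empiricalMMD k (fun i : Fin r => U i ω) (fun j : Fin m => V j ω)
      - errorBound m r sigV sigU) 0 ∂μ ≤ errorBound m r sigV sigU / 2 := by
  set e := errorBound m r sigV sigU
  have he : 0 < e := errorBound_pos hm hsigV.nonneg
  have hsqMMD : ∫ ω, sqMMD k (fun i : Fin r => U i ω) (fun j : Fin m => V j ω) ∂μ ≤ 2 * e ^ 2 :=
    (hU.integral_sqMMD_le hV hkm hk hkb hUV hsigU hsigV hr hm).trans <|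
      mul_le_mul_of_nonneg_left (add_le_errorBound_sq hsigV.nonneg hsigU.nonneg) zero_le_two
  have hUm (i : Fin r) : Measurable (U i) := hU.measurable i
  have hVm (j : Fin m) : Measurable (V j) := hV.measurable j
  calc ∫ ω, max (empiricalMMD k (fun i : Fin r => U i ω) (fun j : Fin m => V j ω) - e) 0 ∂μ
      ≤ ∫ ω, sqMMD k (fun i : Fin r => U i ω) (fun j : Fin m => V j ω) / (4 * e) ∂μ := by
        refine integral_mono
          ((integrable_empiricalMMD hkm hkb hUm hVm).sub (integrable_const e)).pos_part
          ((integrable_sqMMD hkm hkb hUm hVm).div_const _) fun ω => ?_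
        simp only [empiricalMMD_eq_sqrt_sqMMD]
        exact max_sqrt_sub_le_div (sqMMD_nonneg hk _ _) he
    _ ≤ 2 * e ^ 2 / (4 * e) := by
        rw [integral_div]
        gcongr
    _ = e / 2 := by
        field_simp
        norm_num

end IsLagStationary

end WeakDependence

section KernelCusumTime

variable {Ω S : Type*} [MeasurableSpace Ω] [MeasurableSpace S] {μ : Measure Ω}
  [IsProbabilityMeasure μ] {F : Measure (S × S)} [IsProbabilityMeasure F]
  {k : S × S → S × S → ℝ} {X Y : ℕ → Ω → S} {sigX sigY b : ℝ} {m r : ℕ}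

theorem ofReal_le_lintegral_kernelCusumTime (hkm : Measurable (Function.uncurry k))
    (hk : (Matrix.of k).PosSemidef) (hkb : ∀ z w, |k z w| ≤ 1)
    (hX : IsLagStationary μ F (secondOrder X)) (hY : IsLagStationary μ F (secondOrder Y))
    (hXY : ∀ i j, IndepFun (secondOrder X i) (secondOrder Y j) μ)
    (hsigX : WeaklyDependent μ k F (secondOrder X) sigX)
    (hsigY : WeaklyDependent μ k F (secondOrder Y) sigY)
    (hr : 1 ≤ r) (hm : 1 ≤ m) (M : ℕ) (hb : 0 < b) :
    ENNReal.ofReal b ≤ ∫⁻ ω, (kernelCusumTime k sigX sigY m r X Y b M ω : ℝ≥0∞) ∂μ := by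
  let s (t : ℕ) (ω : Ω) : ℝ :=
    empiricalMMD k (fun i : Fin r => secondOrder Y (t + i) ω)
      (fun j : Fin m => secondOrder X j ω) - errorBound m r sigX sigY
  change ENNReal.ofReal b ≤ ∫⁻ ω, (stoppingTime (fun t => s t ω) b M : ℝ≥0∞) ∂μ
  rcases le_total (errorBound m r sigX sigY) 1 with he | he
  · have hint (t : ℕ) : Integrable (s t) μ :=
      (integrable_empiricalMMD hkm hkb (fun i => hY.measurable (t + i))
        fun j => hX.measurable j).sub (integrable_const _)
    have hmean (t : ℕ) : ∫ ω, max (s t ω) 0 ∂μ ≤ 1 / 2 :=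
      ((hY.shift t).integral_max_empiricalMMD_sub_errorBound_le hX hkm hk hkb
        (fun i j => (hXY j (t + i)).symm) (hY.weaklyDependent_shift hkm hk hkb hsigY t) hsigX
        hr hm).trans (by linarith)
    exact (ENNReal.ofReal_le_ofReal (by linarith)).trans
      (ofReal_le_lintegral_stoppingTime hint hmean hb one_half_pos M)
  · have hs (t : ℕ) (ω : Ω) : s t ω ≤ 1 :=
      (sub_le_sub (empiricalMMD_le_two hkb _ _) he).trans (by norm_num)
    calc ENNReal.ofReal b = ∫⁻ _, ENNReal.ofReal (b / 1) ∂μ := by simp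
      _ ≤ ∫⁻ ω, (stoppingTime (fun t => s t ω) b M : ℝ≥0∞) ∂μ :=
          lintegral_mono fun ω => ofReal_div_le_stoppingTime one_pos fun t => hs t ω

end KernelCusumTime

theorem map_compProd_comap {A B C : Type*} [MeasurableSpace A] [MeasurableSpace B]
    [MeasurableSpace C] (ν : Measure A) [SFinite ν] (κ : Kernel B C) [IsSFiniteKernel κ]
    {g : A → B} (hg : Measurable g) :
    (ν ⊗ₘ κ.comap g hg).map (Prod.map g id) = (ν.map g) ⊗ₘ κ := by
  ext s hs
  rw [Measure.map_apply (hg.prodMap measurable_id) hs,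
    Measure.compProd_apply (hg.prodMap measurable_id hs), Measure.compProd_apply hs,
    lintegral_map (Kernel.measurable_kernel_prodMk_left hs) hg]
  rfl

namespace IsMarkovChain

variable {Ω Ω' S : Type*} [MeasurableSpace Ω] [MeasurableSpace Ω'] [MeasurableSpace S]
  {μ : Measure Ω} {μ' : Measure Ω'} {P : Kernel S S} {ν π : Measure S}
  {X : ℕ → Ω → S} {X' : ℕ → Ω' → S}

theorem identDistrib_block (h : IsMarkovChain μ P ν X) (h' : IsMarkovChain μ' P ν X') (n : ℕ) :
    IdentDistrib (fun ω (i : Fin (n + 1)) => X i ω) (fun ω (i : Fin (n + 1)) => X' i ω) μ μ' := by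
  have hX := h.measurable
  have hX' := h'.measurable
  induction n with
  | zero =>
    have hzero : IdentDistrib (X 0) (X' 0) μ μ' :=
      ⟨(hX 0).aemeasurable, (hX' 0).aemeasurable, h.initial.trans h'.initial.symm⟩
    convert hzero.comp (u := fun x (_ : Fin 1) => x) (by fun_prop) using 1 <;>
      · ext ω i
        simp
  | succ n ih =>
    have hstep : IdentDistrib (fun ω => ((fun i : Fin (n + 1) => X i ω), X (n + 1) ω))
        (fun ω => ((fun i : Fin (n + 1) => X' i ω), X' (n + 1) ω)) μ μ' :=
      ⟨by fun_prop, by fun_prop, by rw [h.step, h'.step, ih.map_eq]⟩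
    have hsnoc := (MeasurableEquiv.piFinSuccAbove (fun _ => S) (Fin.last (n + 1))).symm.measurable
    convert (hstep.comp measurable_swap).comp hsnoc using 1 <;>
      · ext ω i
        refine Fin.lastCases ?_ (fun i => ?_) i <;> simp

variable [SFinite μ]

theorem map_zero_one [IsSFiniteKernel P] (h : IsMarkovChain μ P ν X) :
    μ.map (fun ω => (X 0 ω, X 1 ω)) = ν ⊗ₘ P := by
  have hX := h.measurable
  have hstep := congrArg (Measure.map (Prod.map (fun x : Fin 1 → S => x 0) id)) (h.step 0)
  rw [Measure.map_map (by fun_prop) (by fun_prop)] at hstep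
  refine hstep.trans ?_
  refine (map_compProd_comap _ P (measurable_pi_apply (0 : Fin 1))).trans ?_
  rw [Measure.map_map (by fun_prop) (by fun_prop), ← h.initial]
  rfl

theorem tail [IsMarkovKernel P] (h : IsMarkovChain μ P ν X) :
    IsMarkovChain μ P (P ∘ₘ ν) fun i => X (i + 1) where
  measurable i := h.measurable (i + 1)
  initial := by
    have hX := h.measurable
    have : SFinite ν := h.initial ▸ inferInstance
    rw [← Measure.snd_compProd, ← h.map_zero_one, Measure.snd, Measure.map_map (by fun_prop)
      (by fun_prop)]
    rfl
  step n := by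
    have hX := h.measurable
    let dropFirst (x : Fin (n + 2) → S) (i : Fin (n + 1)) : S := x i.succ
    have hdrop : Measurable dropFirst := by fun_prop
    have hstep := congrArg (Measure.map (Prod.map dropFirst id)) (h.step (n + 1))
    rw [Measure.map_map (by fun_prop) (by fun_prop)] at hstep
    refine hstep.trans ?_
    refine (map_compProd_comap _ (P.comap (fun x : Fin (n + 1) → S => x (Fin.last n))
      (measurable_pi_apply _)) hdrop).trans ?_
    rw [Measure.map_map hdrop (by fun_prop)]
    rfl

variable [IsMarkovKernel P] (hπ : Kernel.Invariant P π)

include hπ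

theorem shift (h : IsMarkovChain μ P π X) (a : ℕ) : IsMarkovChain μ P π fun i => X (a + i) := by
  induction a with
  | zero => simpa using h
  | succ a ih =>
    have htail := ih.tail
    rw [hπ.def] at htail
    simpa only [add_assoc, add_comm 1] using htail

theorem isLagStationary_secondOrder (h : IsMarkovChain μ P π X) :
    IsLagStationary μ (π ⊗ₘ P) (secondOrder X) where
  measurable i := (h.measurable i).prodMk (h.measurable (i + 1))
  map_eq i := (h.shift hπ i).map_zero_one
  identDistrib_pair i t := by
    let pairsAtLag (x : Fin (t + 2) → S) : (S × S) × (S × S) :=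
      ((x ⟨t, by omega⟩, x ⟨t + 1, by omega⟩), (x ⟨0, by omega⟩, x ⟨1, by omega⟩))
    have hmeas : Measurable pairsAtLag := by fun_prop
    exact ((h.shift hπ i).identDistrib_block h (t + 1)).comp hmeas

end IsMarkovChain

theorem indepFun_secondOrder {Ω S : Type*} [MeasurableSpace Ω] [MeasurableSpace S]
    {μ : Measure Ω} {X Y : ℕ → Ω → S} (h : IndepFun (fun ω i => X i ω) (fun ω i => Y i ω) μ)
    (i j : ℕ) : IndepFun (secondOrder X i) (secondOrder Y j) μ :=
  h.comp (φ := fun x : ℕ → S => (x i, x (i + 1))) (ψ := fun y : ℕ → S => (y j, y (j + 1)))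
    (by fun_prop) (by fun_prop)

theorem exists_tendsto_zero_of_forall_ofReal_sub_le {f : ℝ → ℝ≥0∞} {c : ℝ}
    (h : ∀ b, ENNReal.ofReal (b - c) ≤ f b) (M α : ℝ) :
    ∃ g : ℝ → ℝ, Tendsto g atTop (𝓝 0) ∧
      ∀ᶠ b : ℝ in atTop, ENNReal.ofReal (M - 1 + (b - α) * (1 + g b)) ≤ f b := by
  refine ⟨fun b => (α + 1 - M - c) / (b - α), ?_, ?_⟩
  · exact tendsto_const_nhds.div_atTop (tendsto_atTop_add_const_right _ (-α) tendsto_id)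
  · filter_upwards [eventually_gt_atTop α] with b hb
    have hbα : b - α ≠ 0 := (sub_pos.2 hb).ne'
    convert h b using 2
    field_simp
    ring

end KernelCusum

open KernelCusum in
theorem mainTheorem1_general {Ω S : Type*} [MeasurableSpace Ω] [MeasurableSpace S]
    {μ : Measure Ω} [IsProbabilityMeasure μ] {F : Measure (S × S)} [IsProbabilityMeasure F]
    {k : S × S → S × S → ℝ} (hkm : Measurable (Function.uncurry k))
    (hk : (Matrix.of k).PosSemidef) (hkb : ∀ z w, |k z w| ≤ 1) {X Y : ℕ → Ω → S}
    (hX : IsLagStationary μ F (secondOrder X)) (hY : IsLagStationary μ F (secondOrder Y))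
    (hXY : ∀ i j, IndepFun (secondOrder X i) (secondOrder Y j) μ) {sigX sigY : ℝ}
    (hsigX : WeaklyDependent μ k F (secondOrder X) sigX)
    (hsigY : WeaklyDependent μ k F (secondOrder Y) sigY)
    {m r : ℕ} (hr : 1 ≤ r) (hm : 1 ≤ m) (M τ : ℕ) (b : ℝ) :
    ENNReal.ofReal (b - τ) ≤ mtbfa μ (kernelCusumTime k sigX sigY m r X Y b M) τ := by
  refine le_trans ?_ (lintegral_sub_le_mtbfa _ τ)
  rw [ENNReal.ofReal_sub _ (Nat.cast_nonneg τ), ENNReal.ofReal_natCast]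
  rcases le_or_gt b 0 with hb | hb
  · simp [ENNReal.ofReal_of_nonpos hb]
  · exact tsub_le_tsub_right
      (ofReal_le_lintegral_kernelCusumTime hkm hk hkb hX hY hXY hsigX hsigY hr hm M hb) _


theorem mainTheorem1 {S : Type*} [MeasurableSpace S]
    (P : Kernel S S) [IsMarkovKernel P] (hP : KernelCusum.Doeblin P)
    (r : ℕ) (hr : 1 ≤ r) :
    ∃ α₁ : ℝ, 0 < α₁ ∧
      ∀ {Ω : Type*} [MeasurableSpace Ω] (μ : Measure Ω) [IsProbabilityMeasure μ]
        (π : Measure S) [IsProbabilityMeasure π] (_hπ : Kernel.Invariant P π)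
        (k : S × S → S × S → ℝ) (_hk_meas : Measurable (Function.uncurry k))
        (_hk_psd : (Matrix.of k).PosSemidef) (_hk_bdd : ∀ z w, |k z w| ≤ 1)
        (X Y : ℕ → Ω → S)
        (_hX : KernelCusum.IsMarkovChain μ P π X) (_hY : KernelCusum.IsMarkovChain μ P π Y)
        (_hXY : IndepFun (fun ω i => X i ω) (fun ω i => Y i ω) μ)
        (sigX sigY : ℝ)
        (_hsigX : KernelCusum.WeaklyDependent μ k (π ⊗ₘ P) (KernelCusum.secondOrder X) sigX)
        (_hsigY : KernelCusum.WeaklyDependent μ k (π ⊗ₘ P) (KernelCusum.secondOrder Y) sigY)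
        (m : ℕ) (_hm : 1 ≤ m) (M τ : ℕ),
        ∃ g : ℝ → ℝ, Tendsto g atTop (𝓝 0) ∧
          ∀ᶠ b : ℝ in atTop,
            ENNReal.ofReal ((M : ℝ) - 1 + (b - α₁) * (1 + g b)) ≤
              KernelCusum.mtbfa μ (KernelCusum.kernelCusumTime k sigX sigY m r X Y b M) τ :=
  ⟨1, one_pos, fun _ _ _ _ hπ _ hkm hk hkb _ _ hX hY hXY _ _ hsigX hsigY _ hm M τ =>
    KernelCusum.exists_tendsto_zero_of_forall_ofReal_sub_le
      (mainTheorem1_general hkm hk hkb (hX.isLagStationary_secondOrder hπ)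
        (hY.isLagStationary_secondOrder hπ) (KernelCusum.indepFun_secondOrder hXY)
        hsigX hsigY hr hm M τ) M 1⟩
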